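/- Let $\mathbb{K}$ be a Hardy field (a field of germs at $+\infty$ of eventually differentiable real functions of a real parameter $t$, closed under differentiation) all of whose elements are germs of functions definable (with parameters) in a fixed polynomially bounded o-minimal expansion of the ordered field $\mathbb{R}$, and assume that $t^r\in\mathbb{K}$ for every $r\in\mathbb{R}$. For a real function $f$ defined near $+\infty$ put $\operatorname{val} f:=\lim_{t\to\infty}\log|f(t)|/\log t\in\mathbb{R}\cup\{\pm\infty\}$, where $\log 0=-\infty$; it depends only on the germ of $f$. Let $\mathbb{T}=\mathbb{R}\cup\{-\infty\}$, let $d,m\ge 0$ be integers with $m\neq d$, and let $A=(a_{ij})\in\mathbb{T}^{d\times m}$. A lift of $A$ is a matrix $\mathbf{A}=(\mathbf{a}_{ij})\in\mathbb{K}_{\ge 0}^{d\times m}$ with $\operatorname{val}\mathbf{a}_{ij}=a_{ij}$ for all $i,j$. Let $\operatorname{vol}\mathbf{A}$ be the germ at $+\infty$ of the function sending $t$ to the $d$-dimensional Lebesgue volume of the convex hull of the columns of $\mathbf{A}(t)$. Then the limit defining $\operatorname{val}\operatorname{vol}\mathbf{A}$ exists for every lift $\mathbf{A}$ of $A$, and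 $$\operatorname{qvol}^+A:=\sup\{\operatorname{val}\operatorname{vol}\mathbf{A} : \mathbf{A}\text{ is a lift of }A\}\;=\;\max_{I\subset[m],\ |I|=d}\operatorname{tdet}A[I].$$ Here $[m]=\{1,\dots,m\}$, $A[I]$ is the $d\times d$ submatrix of $A$ formed by the columns with index in $I$, $\operatorname{tdet}C=\max_{\sigma\in\operatorname{Sym}(d)}\sum_{i=1}^d c_{i\sigma(i)}$ is the tropical determinant (the value of the optimal assignment problem with weights $c_{ij}$), and the maximum over the empty family (the case $m<d$) is $-\infty$. -/

import Mathlib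

open Filter Topology MeasureTheory

universe u v

namespace DequantizedVolume

/-- An expansion of the ordered field of real numbers, given as a first-order structure on `ℝ` in a
language `L`, is o-minimal: order, addition and multiplication are definable, and every subset of
the line that is definable with parameters is a finite union of intervals (points, the empty set
and unbounded intervals included: an order-connected subset of `ℝ` is exactly an interval). -/
structure IsOMinimal (L : FirstOrder.Language.{u, v}) [L.Structure ℝ] : Prop where
  definable_lt : (Set.univ : Set ℝ).Definable L {x : Fin 2 → ℝ | x 0 < x 1}
  definable_add : (Set.univ : Set ℝ).Definable L {x : Fin 3 → ℝ | x 0 + x 1 = x 2}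
  definable_mul : (Set.univ : Set ℝ).Definable L {x : Fin 3 → ℝ | x 0 * x 1 = x 2}
  finite_union : ∀ s : Set ℝ, (Set.univ : Set ℝ).Definable₁ L s →
    ∃ F : Set (Set ℝ), F.Finite ∧ (∀ I ∈ F, I.OrdConnected) ∧ s = ⋃₀ F

/-- A function `ℝ → ℝ` is definable (with parameters), i.e. its graph is. -/
def IsDefinableFun (L : FirstOrder.Language.{u, v}) [L.Structure ℝ] (φ : ℝ → ℝ) : Prop :=
  (Set.univ : Set ℝ).DefinableFun L (fun x : Fin 1 → ℝ => φ (x 0))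

/-- Every definable function of one variable is bounded by a power of `t` near infinity. -/
def IsPolynomiallyBounded (L : FirstOrder.Language.{u, v}) [L.Structure ℝ] : Prop :=
  ∀ φ : ℝ → ℝ, IsDefinableFun L φ → ∃ N : ℕ, ∀ᶠ t in atTop, |φ t| ≤ t ^ N

/-- Germs at `+∞` of real functions of a real parameter. -/
abbrev GermAtInfty : Type := Germ (atTop : Filter ℝ) ℝ

/-- A Hardy field: a subring of the ring of germs at `+∞` that is a field, consists of germs of
eventually differentiable functions, and is closed under differentiation. -/
structure IsHardyField (K : Subring GermAtInfty) : Prop where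
  exists_inv : ∀ f ∈ K, f ≠ 0 → ∃ g ∈ K, f * g = 1
  differentiable : ∀ φ : ℝ → ℝ, (φ : GermAtInfty) ∈ K → ∀ᶠ t in atTop, DifferentiableAt ℝ φ t
  deriv_mem : ∀ φ : ℝ → ℝ, (φ : GermAtInfty) ∈ K → (deriv φ : GermAtInfty) ∈ K

/-- `log |φ t| / log t` as an extended real number, where `log 0 = -∞`. -/
noncomputable def logRatio (φ : ℝ → ℝ) (t : ℝ) : EReal :=
  ENNReal.log (ENNReal.ofReal |φ t|) / (Real.log t : EReal)

/-- The valuation `lim_{t → ∞} log |φ t| / log t`; it depends only on the germ of `φ`. -/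
noncomputable def val (φ : ℝ → ℝ) : EReal :=
  limUnder atTop (logRatio φ)

/-- The matrix of functions `M` represents a matrix with nonnegative entries in `K` whose entrywise
valuation is `A`. -/
def IsLift (K : Subring GermAtInfty) {d m : ℕ} (A : Matrix (Fin d) (Fin m) EReal)
    (M : Matrix (Fin d) (Fin m) (ℝ → ℝ)) : Prop :=
  ∀ i j, (M i j : GermAtInfty) ∈ K ∧ 0 ≤ (M i j : GermAtInfty) ∧ val (M i j) = A i j

/-- The volume of the polytope `conv M` generated by the columns of `M`: its germ at infinity is
represented by the function `t ↦ vol (conv M(t))`, with Lebesgue measure on `ℝ^d`. -/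
noncomputable def vol {d m : ℕ} (M : Matrix (Fin d) (Fin m) (ℝ → ℝ)) (t : ℝ) : ℝ :=
  (volume : Measure (Fin d → ℝ)).real
    (convexHull ℝ (Set.range fun (j : Fin m) (i : Fin d) => M i j t))

/-- The upper dequantized tropical volume: the supremum of `val (vol M)` over all lifts. -/
noncomputable def upperVolume (K : Subring GermAtInfty) {d m : ℕ}
    (A : Matrix (Fin d) (Fin m) EReal) : EReal :=
  sSup {v : EReal | ∃ M : Matrix (Fin d) (Fin m) (ℝ → ℝ), IsLift K A M ∧ v = val (vol M)}

/-- The tropical determinant: the value of the optimal assignment problem with weights `C`. -/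
noncomputable def tropDet {d : ℕ} (C : Matrix (Fin d) (Fin d) EReal) : EReal :=
  ⨆ σ : Equiv.Perm (Fin d), ∑ i, C i (σ i)

/-- The submatrix of `A` with all rows and with the columns in `I`, in increasing order. -/
def columnSubmatrix {d m : ℕ} (A : Matrix (Fin d) (Fin m) EReal) (I : Finset (Fin m))
    (hI : I.card = d) : Matrix (Fin d) (Fin d) EReal :=
  A.submatrix id (I.orderEmbOfFin hI)

end DequantizedVolume

/-!
Comparing an element of the Hardy field with the powers
`t ^ r`, which belong to it, shows that its absolute value is eventually on one side of each of them;
hence `log |f t| / log t` converges in the extended reals for every element `f`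
(`IsHardyField.tendsto_logRatio_val`).

The simplex with vertices `p 0, …, p d` has volume `c * |det N|`, where `c > 0` depends only on `d`
and `N` is the matrix of coordinates of the vertices with a row of ones added (`volume_simplex`). A
polytope contains every simplex spanned by its vertices and, by Carathéodory's theorem, is the union
of them. Its volume therefore lies between the largest of these simplex volumes and their sum, so
that the valuation of the volume exists and is the largest valuation of a homogenized determinant
`simplexDet M g`, which lies in the field (`tendsto_logRatio_vol`).

For the upper bound, expand `simplexDet M g` along the row of ones and then by the Leibniz formula:
every nonzero term is a product of entries along an injection `Fin d → Fin m`
(`growthLE_simplexDet`).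

For the lower bound, let an injection `h : Fin d → Fin m` be given. As `m ≠ d`, there is a column
`j₀` outside its range. The homogenized determinant of the columns `j₀, h 0, …, h (d - 1)` is affine
in each of the entries `(i, h i)`, and the coefficient of their product is `1`. Taking the iterated
difference when each of these entries is either `t ^ A i (h i)` or twice that writes
`∏ i, t ^ A i (h i)` as an alternating sum of `2 ^ d` homogenized determinants of lifts of `A`
(`prod_tropicalPower_le_sum`). One of them must be at least as large as the product in valuation,
which excludes any cancellation of leading terms for that lift.
-/

namespace DequantizedVolume

/-! ### Growth orders at infinity -/

/-- The function `f` grows at most like `t ^ a`, up to arbitrarily small powers of `t`. -/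
def GrowthLE (f : ℝ → ℝ) (a : EReal) : Prop :=
  ∀ r : ℝ, a < r → ∀ᶠ t in atTop, |f t| ≤ t ^ r

/-- The function `f` grows at least like `t ^ a`, up to arbitrarily small powers of `t`. -/
def GrowthGE (f : ℝ → ℝ) (a : EReal) : Prop :=
  ∀ r : ℝ, (r : EReal) < a → ∀ᶠ t in atTop, t ^ r ≤ |f t|

theorem logRatio_of_eq_zero {f : ℝ → ℝ} {t : ℝ} (ht : 1 < t) (h : f t = 0) :
    logRatio f t = ⊥ := by
  have hlog : (0 : EReal) < (Real.log t : EReal) := by exact_mod_cast Real.log_pos ht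
  simp only [logRatio, h, abs_zero, ENNReal.ofReal_zero, ENNReal.log_zero]
  exact EReal.bot_div_of_pos_ne_top hlog (EReal.coe_ne_top _)

theorem logRatio_of_ne_zero {f : ℝ → ℝ} {t : ℝ} (h : f t ≠ 0) :
    logRatio f t = ((Real.log |f t| / Real.log t : ℝ) : EReal) := by
  rw [logRatio, ENNReal.log_ofReal_of_pos (abs_pos.2 h), EReal.coe_div]

theorem logRatio_le_coe_iff {f : ℝ → ℝ} {t : ℝ} (ht : 1 < t) (r : ℝ) :
    logRatio f t ≤ r ↔ |f t| ≤ t ^ r := by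
  have ht0 : 0 < t := by linarith
  rcases eq_or_ne (f t) 0 with h | h
  · simp [logRatio_of_eq_zero ht h, h, (Real.rpow_pos_of_pos ht0 r).le]
  · rw [logRatio_of_ne_zero h, EReal.coe_le_coe_iff, div_le_iff₀ (Real.log_pos ht),
      ← Real.log_rpow ht0, Real.log_le_log_iff (abs_pos.2 h) (Real.rpow_pos_of_pos ht0 r)]

theorem coe_le_logRatio_iff {f : ℝ → ℝ} {t : ℝ} (ht : 1 < t) (r : ℝ) :
    r ≤ logRatio f t ↔ t ^ r ≤ |f t| := by
  have ht0 : 0 < t := by linarith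
  rcases eq_or_ne (f t) 0 with h | h
  · simp [logRatio_of_eq_zero ht h, h, Real.rpow_pos_of_pos ht0 r]
  · rw [logRatio_of_ne_zero h, EReal.coe_le_coe_iff, le_div_iff₀ (Real.log_pos ht),
      ← Real.log_rpow ht0, Real.log_le_log_iff (Real.rpow_pos_of_pos ht0 r) (abs_pos.2 h)]

theorem tendsto_logRatio_iff {f : ℝ → ℝ} {a : EReal} :
    Tendsto (logRatio f) atTop (𝓝 a) ↔ GrowthLE f a ∧ GrowthGE f a := by
  rw [tendsto_order]
  constructor
  · rintro ⟨h1, h2⟩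
    constructor
    · intro r hr
      filter_upwards [h2 r hr, eventually_gt_atTop 1] with t ht ht1
      exact (logRatio_le_coe_iff ht1 r).1 ht.le
    · intro r hr
      filter_upwards [h1 r hr, eventually_gt_atTop 1] with t ht ht1
      exact (coe_le_logRatio_iff ht1 r).1 ht.le
  · rintro ⟨h1, h2⟩
    constructor
    · intro b hb
      obtain ⟨r, hbr, hra⟩ := EReal.lt_iff_exists_real_btwn.1 hb
      filter_upwards [h2 r hra, eventually_gt_atTop 1] with t ht ht1
      exact hbr.trans_le ((coe_le_logRatio_iff ht1 r).2 ht)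
    · intro b hb
      obtain ⟨r, har, hrb⟩ := EReal.lt_iff_exists_real_btwn.1 hb
      filter_upwards [h1 r har, eventually_gt_atTop 1] with t ht ht1
      exact ((logRatio_le_coe_iff ht1 r).2 ht).trans_lt hrb

theorem val_eq_of_tendsto {f : ℝ → ℝ} {a : EReal} (h : Tendsto (logRatio f) atTop (𝓝 a)) :
    val f = a :=
  h.limUnder_eq

theorem eventually_mul_rpow_le_rpow (C : ℝ) {r s : ℝ} (hrs : r < s) :
    ∀ᶠ t : ℝ in atTop, C * t ^ r ≤ t ^ s := by
  filter_upwards [(tendsto_rpow_atTop (sub_pos.2 hrs)).eventually_ge_atTop C,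
    eventually_gt_atTop 0] with t ht ht0
  calc C * t ^ r ≤ t ^ (s - r) * t ^ r :=
        mul_le_mul_of_nonneg_right ht (Real.rpow_nonneg ht0.le r)
    _ = t ^ s := by rw [← Real.rpow_add ht0, sub_add_cancel]

theorem GrowthLE.mono {f : ℝ → ℝ} {a b : EReal} (h : GrowthLE f a) (hab : a ≤ b) :
    GrowthLE f b :=
  fun r hr => h r (hab.trans_lt hr)

theorem GrowthLE.of_abs_le_sum {ι : Type*} [Fintype ι] {f : ℝ → ℝ} {F : ι → ℝ → ℝ} {a : EReal}
    (c : ℝ) (hc : 0 ≤ c) (hF : ∀ i, GrowthLE (F i) a)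
    (h : ∀ᶠ t in atTop, |f t| ≤ c * ∑ i, |F i t|) : GrowthLE f a := by
  intro r hr
  obtain ⟨s, has, hsr⟩ := EReal.lt_iff_exists_real_btwn.1 hr
  filter_upwards [h, eventually_all.2 fun i => hF i s has,
    eventually_mul_rpow_le_rpow (c * Fintype.card ι) (EReal.coe_lt_coe_iff.1 hsr)] with t h ht hC
  calc |f t| ≤ c * ∑ i, |F i t| := h
    _ ≤ c * ∑ _i : ι, t ^ s := by gcongr with i; exact ht i
    _ = c * Fintype.card ι * t ^ s := by simp [mul_assoc]
    _ ≤ t ^ r := hC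

theorem GrowthGE.of_mul_abs_le {f g : ℝ → ℝ} {a : EReal} {c : ℝ} (hc : 0 < c)
    (hf : GrowthGE f a) (h : ∀ t, c * |f t| ≤ |g t|) : GrowthGE g a := by
  intro r hr
  obtain ⟨s, hrs, hsa⟩ := EReal.lt_iff_exists_real_btwn.1 hr
  filter_upwards [hf s hsa, eventually_mul_rpow_le_rpow c⁻¹ (EReal.coe_lt_coe_iff.1 hrs)]
    with t ht hC
  calc t ^ r = c * (c⁻¹ * t ^ r) := by field_simp
    _ ≤ c * t ^ s := by gcongr
    _ ≤ c * |f t| := by gcongr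
    _ ≤ |g t| := h t

theorem GrowthGE.le_of_growthLE {f : ℝ → ℝ} {a b : EReal} (ha : GrowthGE f a) (hb : GrowthLE f b) :
    a ≤ b := by
  by_contra! hlt
  obtain ⟨r, hbr, hra⟩ := EReal.lt_iff_exists_real_btwn.1 hlt
  obtain ⟨s, hrs, hsa⟩ := EReal.lt_iff_exists_real_btwn.1 hra
  obtain ⟨t, h1, h2, ht⟩ := ((ha s hsa).and ((hb r hbr).and (eventually_gt_atTop 1))).exists
  exact (Real.rpow_lt_rpow_of_exponent_lt ht (EReal.coe_lt_coe_iff.1 hrs)).not_ge (h1.trans h2)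

theorem exists_coe_add_eq_of_add_lt {a b : EReal} (ha : a ≠ ⊤) (hb : b ≠ ⊤) {r : ℝ}
    (h : a + b < r) : ∃ x y : ℝ, a < x ∧ b < y ∧ x + y = r := by
  induction a with
  | top => exact absurd rfl ha
  | bot =>
    obtain ⟨y, hy, -⟩ := EReal.lt_iff_exists_real_btwn.1 (lt_top_iff_ne_top.2 hb)
    exact ⟨r - y, y, EReal.bot_lt_coe _, hy, by ring⟩
  | coe a =>
    induction b with
    | top => exact absurd rfl hb
    | bot =>
      exact ⟨a + 1, r - (a + 1), by exact_mod_cast lt_add_one a, EReal.bot_lt_coe _, by ring⟩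
    | coe b =>
      have h' : a + b < r := by exact_mod_cast h
      refine ⟨a + (r - (a + b)) / 2, b + (r - (a + b)) / 2, ?_, ?_, by ring⟩ <;>
      · rw [EReal.coe_lt_coe_iff]; linarith

theorem GrowthLE.mul {f g : ℝ → ℝ} {a b : EReal} (hf : GrowthLE f a) (hg : GrowthLE g b)
    (ha : a ≠ ⊤) (hb : b ≠ ⊤) : GrowthLE (fun t => f t * g t) (a + b) := by
  intro r hr
  obtain ⟨x, y, hx, hy, rfl⟩ := exists_coe_add_eq_of_add_lt ha hb hr
  filter_upwards [hf x hx, hg y hy, eventually_gt_atTop 0] with t h1 h2 ht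
  rw [abs_mul, Real.rpow_add ht]
  gcongr

theorem sum_ne_top {ι : Type*} (s : Finset ι) {a : ι → EReal} (ha : ∀ i, a i ≠ ⊤) :
    ∑ i ∈ s, a i ≠ ⊤ := by
  classical
  induction s using Finset.induction_on with
  | empty => simp
  | insert i s hi ih =>
    rw [Finset.sum_insert hi]
    exact (EReal.add_lt_top (ha i) ih).ne

theorem GrowthLE.prod {ι : Type*} (s : Finset ι) {f : ι → ℝ → ℝ} {a : ι → EReal}
    (hf : ∀ i, GrowthLE (f i) (a i)) (ha : ∀ i, a i ≠ ⊤) :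
    GrowthLE (fun t => ∏ i ∈ s, f i t) (∑ i ∈ s, a i) := by
  classical
  induction s using Finset.induction_on with
  | empty =>
    intro r hr
    have hr0 : 0 < r := by simpa using hr
    filter_upwards [eventually_ge_atTop 1] with t ht
    simpa using Real.one_le_rpow ht hr0.le
  | insert i s hi ih =>
    simp only [Finset.prod_insert hi, Finset.sum_insert hi]
    exact (hf i).mul ih (ha i) (sum_ne_top s ha)

/-- The monomial `t ^ a`, with the convention `t ^ ⊥ = 0`. The value at `a = ⊤` is junk. -/
noncomputable def tropicalPower (a : EReal) (t : ℝ) : ℝ :=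
  if a = ⊥ then 0 else t ^ a.toReal

theorem tropicalPower_add {a b : EReal} (ha : a ≠ ⊤) (hb : b ≠ ⊤) {t : ℝ} (ht : 0 < t) :
    tropicalPower (a + b) t = tropicalPower a t * tropicalPower b t := by
  induction a with
  | top => exact absurd rfl ha
  | bot => simp [tropicalPower]
  | coe a =>
    induction b with
    | top => exact absurd rfl hb
    | bot => simp [tropicalPower]
    | coe b =>
      rw [← EReal.coe_add]
      simp [tropicalPower, Real.rpow_add ht, -EReal.coe_add]

theorem tropicalPower_sum {ι : Type*} (s : Finset ι) {a : ι → EReal} (ha : ∀ i, a i ≠ ⊤) {t : ℝ}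
    (ht : 0 < t) : tropicalPower (∑ i ∈ s, a i) t = ∏ i ∈ s, tropicalPower (a i) t := by
  classical
  induction s using Finset.induction_on with
  | empty => simp [tropicalPower]
  | insert i s hi ih =>
    rw [Finset.sum_insert hi, Finset.prod_insert hi,
      tropicalPower_add (ha i) (sum_ne_top s ha) ht, ih]

theorem tropicalPower_nonneg (a : EReal) {t : ℝ} (ht : 0 ≤ t) : 0 ≤ tropicalPower a t := by
  unfold tropicalPower
  split_ifs
  exacts [le_rfl, Real.rpow_nonneg ht _]

theorem tendsto_logRatio_const_mul_tropicalPower {c : ℝ} (hc : c ≠ 0) {a : EReal} (ha : a ≠ ⊤) :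
    Tendsto (logRatio fun t => c * tropicalPower a t) atTop (𝓝 a) := by
  rw [tendsto_logRatio_iff]
  induction a with
  | top => exact absurd rfl ha
  | bot =>
    refine ⟨fun r _ => ?_, fun r hr => absurd hr not_lt_bot⟩
    filter_upwards [eventually_ge_atTop 0] with t ht
    simpa [tropicalPower] using Real.rpow_nonneg ht r
  | coe a =>
    simp only [tropicalPower, EReal.coe_ne_bot, if_false, EReal.toReal_coe]
    refine ⟨fun r hr => ?_, fun r hr => ?_⟩
    · filter_upwards [eventually_mul_rpow_le_rpow |c| (EReal.coe_lt_coe_iff.1 hr),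
        eventually_ge_atTop 0] with t ht ht0
      rwa [abs_mul, abs_of_nonneg (Real.rpow_nonneg ht0 a)]
    · filter_upwards [eventually_mul_rpow_le_rpow |c|⁻¹ (EReal.coe_lt_coe_iff.1 hr),
        eventually_ge_atTop 0] with t ht ht0
      rw [abs_mul, abs_of_nonneg (Real.rpow_nonneg ht0 a)]
      rwa [inv_mul_le_iff₀ (abs_pos.2 hc)] at ht

/-! ### Valuations on a Hardy field -/

/-- A nonzero element of a Hardy field is represented by a function that is eventually continuous
and eventually nonvanishing, so it has constant sign by the intermediate value theorem. -/
theorem IsHardyField.eventually_nonneg_or_nonpos {K : Subring GermAtInfty} (hK : IsHardyField K)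
    {f : ℝ → ℝ} (hf : (f : GermAtInfty) ∈ K) :
    (∀ᶠ t in atTop, 0 ≤ f t) ∨ ∀ᶠ t in atTop, f t ≤ 0 := by
  by_cases h0 : (f : GermAtInfty) = 0
  · left
    filter_upwards [Germ.coe_eq.1 h0] with t ht
    simp [ht]
  obtain ⟨g, -, hg⟩ := hK.exists_inv _ hf h0
  have hne : ∀ᶠ t in atTop, f t ≠ 0 := by
    induction g using Germ.inductionOn with
    | _ g =>
      have h1 : (fun t => f t * g t) =ᶠ[atTop] fun _ => 1 := Germ.coe_eq.1 hg
      filter_upwards [h1] with t ht h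
      simp [h] at ht
  obtain ⟨T, hT⟩ := eventually_atTop.1 (hne.and (hK.differentiable f hf))
  have hcont : ∀ t, ContinuousOn f (Set.Icc T t) := fun t s hs =>
    (hT s hs.1).2.continuousAt.continuousWithinAt
  rcases lt_or_ge (f T) 0 with hfT | hfT
  · right
    filter_upwards [eventually_ge_atTop T] with t ht
    by_contra! hlt
    obtain ⟨s, hs, hs0⟩ := intermediate_value_Icc ht (hcont t) ⟨hfT.le, hlt.le⟩
    exact (hT s hs.1).1 hs0
  · left
    filter_upwards [eventually_ge_atTop T] with t ht
    by_contra! hlt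
    obtain ⟨s, hs, hs0⟩ := intermediate_value_Icc' ht (hcont t) ⟨hlt.le, hfT⟩
    exact (hT s hs.1).1 hs0

/-- Elements of the Hardy field have a valuation: comparing `f` and `-f` with the powers of `t`, all
of which belong to the field, shows that `logRatio f` cannot oscillate around a real number. -/
theorem IsHardyField.tendsto_logRatio_val {K : Subring GermAtInfty} (hK : IsHardyField K)
    (hpow : ∀ r : ℝ, ((fun t : ℝ => t ^ r : ℝ → ℝ) : GermAtInfty) ∈ K)
    {f : ℝ → ℝ} (hf : (f : GermAtInfty) ∈ K) :
    Tendsto (logRatio f) atTop (𝓝 (val f)) := by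
  have key : ∀ r : ℝ, (∀ᶠ t in atTop, |f t| ≤ t ^ r) ∨ ∀ᶠ t in atTop, t ^ r ≤ |f t| := by
    intro r
    have h1 := hK.eventually_nonneg_or_nonpos (f := fun t => t ^ r - f t) (K.sub_mem (hpow r) hf)
    have h2 := hK.eventually_nonneg_or_nonpos (f := fun t => t ^ r + f t) (K.add_mem (hpow r) hf)
    rcases h1 with h1 | h1
    · rcases h2 with h2 | h2
      · left
        filter_upwards [h1, h2] with t h1 h2
        exact abs_le.2 ⟨by linarith, by linarith⟩
      · right
        filter_upwards [h2] with t h2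
        exact le_abs.2 (Or.inr (by linarith))
    · right
      filter_upwards [h1] with t h1
      exact le_abs.2 (Or.inl (by linarith))
  obtain ⟨c, hc⟩ : ∃ c, Tendsto (logRatio f) atTop (𝓝 c) := by
    refine tendsto_of_no_upcrossings dense_univ fun a _ b _ hab h => ?_
    obtain ⟨r, har, hrb⟩ := EReal.lt_iff_exists_real_btwn.1 hab
    rcases key r with hr | hr
    · refine h.2 ?_
      filter_upwards [hr, eventually_gt_atTop 1] with t ht ht1
      exact not_lt.2 (((logRatio_le_coe_iff ht1 r).2 ht).trans hrb.le)
    · refine h.1 ?_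
      filter_upwards [hr, eventually_gt_atTop 1] with t ht ht1
      exact not_lt.2 (har.le.trans ((coe_le_logRatio_iff ht1 r).2 ht))
  rwa [val_eq_of_tendsto hc]

open scoped Pointwise

/-! ### Volumes of simplices and polytopes -/

/-- The square matrix with a row of ones on top of the coordinates of the points `p 0, …, p d`. -/
def homogenize {d : ℕ} (p : Fin (d + 1) → Fin d → ℝ) : Matrix (Fin (d + 1)) (Fin (d + 1)) ℝ :=
  Matrix.of (Fin.cons (fun _ => 1) fun i k => p k i)

@[simp]
theorem homogenize_zero {d : ℕ} (p : Fin (d + 1) → Fin d → ℝ) (k : Fin (d + 1)) :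
    homogenize p 0 k = 1 := rfl

@[simp]
theorem homogenize_succ {d : ℕ} (p : Fin (d + 1) → Fin d → ℝ) (i : Fin d) (k : Fin (d + 1)) :
    homogenize p i.succ k = p k i := rfl

theorem det_homogenize_eq_det_sub {d : ℕ} (p : Fin (d + 1) → Fin d → ℝ) :
    (homogenize p).det = (Matrix.of fun i k : Fin d => p k.succ i - p 0 i).det := by
  -- Subtract the first vertex from the others; the row of ones turns into a unit vector.
  let B : Matrix (Fin (d + 1)) (Fin (d + 1)) ℝ := (homogenize p).transpose
  let c : Fin (d + 1) → ℝ := Fin.cons 0 fun _ => -1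
  have h1 : (Matrix.of fun k j => B k j + c k * B 0 j).det = B.det :=
    Matrix.det_eq_of_forall_row_eq_smul_add_const c 0 rfl fun _ _ => rfl
  rw [← Matrix.det_transpose, ← Matrix.det_transpose (Matrix.of _)]
  change B.det = _
  rw [← h1, Matrix.det_succ_column_zero, Fin.sum_univ_succ]
  simp only [B, c, Matrix.of_apply, Matrix.transpose_apply, homogenize_zero, Fin.cons_zero,
    Fin.cons_succ, Fin.succAbove_zero]
  simp only [Fin.val_zero, pow_zero, zero_mul, add_zero, mul_one, one_mul, add_neg_cancel,
    mul_zero, Finset.sum_const_zero]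
  congr 1
  ext k j
  simp [sub_eq_add_neg]

/-- The vertices of the standard `d`-simplex spanned by the origin and the unit vectors. -/
def cornerVertices (d : ℕ) : Fin (d + 1) → Fin d → ℝ :=
  Fin.cons 0 fun k => Pi.single k 1

/-- The volume of the simplex spanned by the origin and the unit vectors. -/
noncomputable def cornerVolume (d : ℕ) : ℝ :=
  (volume : Measure (Fin d → ℝ)).real (convexHull ℝ (Set.range (cornerVertices d)))

theorem isCompact_convexHull_range {ι : Type*} [Finite ι] {d : ℕ} (p : ι → Fin d → ℝ) :
    IsCompact (convexHull ℝ (Set.range p)) :=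
  (Set.finite_range p).isCompact_convexHull ℝ

theorem volume_convexHull_range_ne_top {ι : Type*} [Finite ι] {d : ℕ} (p : ι → Fin d → ℝ) :
    (volume : Measure (Fin d → ℝ)) (convexHull ℝ (Set.range p)) ≠ ⊤ :=
  (isCompact_convexHull_range p).measure_lt_top.ne

theorem cornerVolume_pos (d : ℕ) : 0 < cornerVolume d := by
  refine ENNReal.toReal_pos ?_ (volume_convexHull_range_ne_top _)
  refine (Measure.measure_pos_of_nonempty_interior _ ?_).ne'
  rw [interior_convexHull_nonempty_iff_affineSpan_eq_top, cornerVertices, Fin.range_cons]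
  apply SetLike.coe_injective
  rw [affineSpan_insert_zero]
  have h : Set.range (fun k : Fin d => (Pi.single k 1 : Fin d → ℝ))
      = Set.range (Pi.basisFun ℝ (Fin d)) := by
    congr 1
    ext1 k
    simp
  rw [h, (Pi.basisFun ℝ (Fin d)).span_eq]
  rfl

theorem volume_simplex {d : ℕ} (p : Fin (d + 1) → Fin d → ℝ) :
    (volume : Measure (Fin d → ℝ)).real (convexHull ℝ (Set.range p))
      = cornerVolume d * |(homogenize p).det| := by
  let Q : Matrix (Fin d) (Fin d) ℝ := Matrix.of fun i k => p k.succ i - p 0 i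
  have hp : Set.range p = p 0 +ᵥ (Matrix.toLin' Q '' Set.range (cornerVertices d)) := by
    rw [← Set.image_vadd, ← Set.range_comp, ← Set.range_comp]
    congr 1
    ext k i
    refine Fin.cases ?_ (fun k => ?_) k
    · simp [cornerVertices]
    · simp [cornerVertices, Q]
  rw [hp, convexHull_vadd, ← LinearMap.image_convexHull, measureReal_def, measure_vadd,
    Measure.addHaar_image_linearMap, LinearMap.det_toLin', ENNReal.toReal_mul,
    ENNReal.toReal_ofReal (abs_nonneg _), det_homogenize_eq_det_sub, mul_comm]
  rfl

/-- **Carathéodory's theorem** for an indexed family of points: repeated vertices are allowed, so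
that the simplices can be indexed by all maps `Fin (d + 1) → ι`. -/
theorem convexHull_range_subset_iUnion {ι : Type*} {d : ℕ} (p : ι → Fin d → ℝ) :
    convexHull ℝ (Set.range p) ⊆
      ⋃ g : Fin (d + 1) → ι, convexHull ℝ (Set.range fun k => p (g k)) := by
  intro x hx
  rw [convexHull_eq_union] at hx
  simp only [Set.mem_iUnion] at hx
  obtain ⟨s, hs, hind, hxs⟩ := hx
  have hcard : s.card ≤ d + 1 := by
    have := hind.card_le_finrank_succ.trans
      (Nat.add_le_add_right (Submodule.finrank_le _) 1)
    simpa using this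
  have hne : s.Nonempty := by
    rw [Finset.nonempty_iff_ne_empty]
    rintro rfl
    simp at hxs
  obtain ⟨y, hy⟩ := hne
  have : Nonempty s := ⟨⟨y, hy⟩⟩
  obtain ⟨e, he⟩ : ∃ e : Fin (d + 1) → s, Function.Surjective e := by
    refine ⟨fun k => if h : k.1 < s.card then s.equivFin.symm ⟨k.1, h⟩ else ⟨y, hy⟩, fun z => ?_⟩
    refine ⟨⟨(s.equivFin z).1, (s.equivFin z).2.trans_le hcard⟩, ?_⟩
    simp
  choose g hg using fun k => hs (e k).2
  refine Set.mem_iUnion.2 ⟨g, ?_⟩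
  have hr : (Set.range fun k => p (g k)) = (s : Set (Fin d → ℝ)) := by
    simp only [hg]
    ext z
    constructor
    · rintro ⟨k, rfl⟩
      exact (e k).2
    · intro hz
      obtain ⟨k, hk⟩ := he ⟨z, hz⟩
      exact ⟨k, by simp [hk]⟩
  rwa [hr]

theorem simplex_volume_le {ι : Type*} [Finite ι] {d : ℕ} (p : ι → Fin d → ℝ)
    (g : Fin (d + 1) → ι) :
    cornerVolume d * |(homogenize fun k => p (g k)).det| ≤
      (volume : Measure (Fin d → ℝ)).real (convexHull ℝ (Set.range p)) := by
  rw [← volume_simplex]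
  refine measureReal_mono (convexHull_mono ?_) (volume_convexHull_range_ne_top p)
  rintro _ ⟨k, rfl⟩
  exact ⟨g k, rfl⟩

theorem volume_convexHull_range_le {ι : Type*} [Fintype ι] {d : ℕ} (p : ι → Fin d → ℝ) :
    (volume : Measure (Fin d → ℝ)).real (convexHull ℝ (Set.range p)) ≤
      cornerVolume d * ∑ g : Fin (d + 1) → ι, |(homogenize fun k => p (g k)).det| := by
  classical
  rw [Finset.mul_sum]
  simp only [← volume_simplex]
  refine (measureReal_mono (convexHull_range_subset_iUnion p) ?_).trans
    (measureReal_iUnion_fintype_le _)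
  refine ((measure_iUnion_fintype_le _ _).trans_lt ?_).ne
  exact ENNReal.sum_lt_top.2 fun g _ => (volume_convexHull_range_ne_top _).lt_top

/-! ### The valuation of the volume -/

/-- The homogenized determinant of the columns `g 0, …, g d` of a matrix of functions. -/
noncomputable def simplexDet {d m : ℕ} (M : Matrix (Fin d) (Fin m) (ℝ → ℝ))
    (g : Fin (d + 1) → Fin m) (t : ℝ) : ℝ :=
  (homogenize fun k i => M i (g k) t).det

theorem abs_vol {d m : ℕ} (M : Matrix (Fin d) (Fin m) (ℝ → ℝ)) (t : ℝ) : |vol M t| = vol M t :=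
  abs_of_nonneg measureReal_nonneg

theorem mul_abs_simplexDet_le {d m : ℕ} (M : Matrix (Fin d) (Fin m) (ℝ → ℝ))
    (g : Fin (d + 1) → Fin m) (t : ℝ) : cornerVolume d * |simplexDet M g t| ≤ |vol M t| := by
  rw [abs_vol]
  exact simplex_volume_le (fun j i => M i j t) g

theorem abs_vol_le {d m : ℕ} (M : Matrix (Fin d) (Fin m) (ℝ → ℝ)) (t : ℝ) :
    |vol M t| ≤ cornerVolume d * ∑ g : Fin (d + 1) → Fin m, |simplexDet M g t| := by
  rw [abs_vol]
  exact volume_convexHull_range_le fun j i => M i j t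

/-- A determinant of functions whose germs lie in a subring has its germ in that subring. -/
theorem coe_det_mem {K : Subring GermAtInfty} {n : ℕ} (N : Matrix (Fin n) (Fin n) (ℝ → ℝ))
    (hN : ∀ i j, (N i j : GermAtInfty) ∈ K) :
    ((fun t => (Matrix.of fun i j => N i j t).det : ℝ → ℝ) : GermAtInfty) ∈ K := by
  let φ : (ℝ → ℝ) →+* GermAtInfty := Germ.coeRingHom atTop
  have h : (fun t => (Matrix.of fun i j => N i j t).det) = N.det := by
    ext t
    exact (RingHom.map_det (Pi.evalRingHom (fun _ : ℝ => ℝ) t) N).symm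
  rw [h]
  change φ N.det ∈ K
  rw [RingHom.map_det, Matrix.det_apply]
  refine K.sum_mem fun σ _ => ?_
  rw [Units.smul_def]
  exact K.zsmul_mem (K.prod_mem fun i _ => hN _ _) _

theorem simplexDet_mem {K : Subring GermAtInfty} {d m : ℕ} {M : Matrix (Fin d) (Fin m) (ℝ → ℝ)}
    (hM : ∀ i j, (M i j : GermAtInfty) ∈ K) (g : Fin (d + 1) → Fin m) :
    ((simplexDet M g : ℝ → ℝ) : GermAtInfty) ∈ K := by
  let N : Matrix (Fin (d + 1)) (Fin (d + 1)) (ℝ → ℝ) :=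
    Matrix.of (Fin.cons (fun _ => 1) fun i k => M i (g k))
  have hN : ∀ i k, (N i k : GermAtInfty) ∈ K := by
    intro i k
    refine Fin.cases K.one_mem (fun i => hM i (g k)) i
  have h : simplexDet M g = fun t => (Matrix.of fun i j => N i j t).det := by
    ext t
    rw [simplexDet]
    congr 1
    ext i k
    refine Fin.cases ?_ (fun i => ?_) i <;> rfl
  rw [h]
  exact coe_det_mem N hN

/-- The volume is squeezed between the largest simplex and the sum of all simplices, so its
valuation is the largest valuation of a homogenized determinant. -/
theorem tendsto_logRatio_vol {d m : ℕ} {M : Matrix (Fin d) (Fin m) (ℝ → ℝ)}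
    {v : (Fin (d + 1) → Fin m) → EReal}
    (hv : ∀ g, Tendsto (logRatio (simplexDet M g)) atTop (𝓝 (v g))) :
    Tendsto (logRatio (vol M)) atTop (𝓝 (⨆ g, v g)) := by
  rw [tendsto_logRatio_iff]
  constructor
  · exact GrowthLE.of_abs_le_sum _ (cornerVolume_pos d).le
      (fun g => (tendsto_logRatio_iff.1 (hv g)).1.mono (le_iSup v g))
      (Eventually.of_forall (abs_vol_le M))
  · intro r hr
    obtain ⟨g, hg⟩ := lt_iSup_iff.1 hr
    exact (tendsto_logRatio_iff.1 (hv g)).2.of_mul_abs_le (cornerVolume_pos d)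
      (mul_abs_simplexDet_le M g) r hg

/-! ### The upper bound -/

/-- The maximum of the tropical minors of `A` of size `d`. -/
noncomputable def maxTropicalMinor {d m : ℕ} (A : Matrix (Fin d) (Fin m) EReal) : EReal :=
  ⨆ (I : Finset (Fin m)) (hI : I.card = d), tropDet (columnSubmatrix A I hI)

theorem sum_le_maxTropicalMinor {d m : ℕ} (A : Matrix (Fin d) (Fin m) EReal) {h : Fin d → Fin m}
    (hh : Function.Injective h) : ∑ i, A i (h i) ≤ maxTropicalMinor A := by
  let I : Finset (Fin m) := Finset.univ.image h
  have hI : I.card = d := by simp [I, Finset.card_image_of_injective _ hh]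
  have hmem : ∀ i, h i ∈ Set.range (I.orderEmbOfFin hI) := by
    intro i
    rw [Finset.range_orderEmbOfFin]
    simp [I]
  choose σ hσ using hmem
  have hσi : Function.Injective σ := fun i j hij => hh (by rw [← hσ i, ← hσ j, hij])
  refine le_iSup₂_of_le I hI
    (le_iSup_of_le (Equiv.ofBijective σ (Finite.injective_iff_bijective.1 hσi)) ?_)
  simp [columnSubmatrix, hσ]

theorem maxTropicalMinor_le {d m : ℕ} {A : Matrix (Fin d) (Fin m) EReal} {b : EReal}
    (hb : ∀ h : Fin d → Fin m, Function.Injective h → ∑ i, A i (h i) ≤ b) :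
    maxTropicalMinor A ≤ b :=
  iSup₂_le fun I hI => iSup_le fun σ =>
    hb (fun i => I.orderEmbOfFin hI (σ i)) ((I.orderEmbOfFin hI).injective.comp σ.injective)

theorem growthLE_det {d m : ℕ} {A : Matrix (Fin d) (Fin m) EReal} (hA : ∀ i j, A i j ≠ ⊤)
    {M : Matrix (Fin d) (Fin m) (ℝ → ℝ)} (hM : ∀ i j, GrowthLE (M i j) (A i j))
    (h : Fin d → Fin m) :
    GrowthLE (fun t => (Matrix.of fun i j => M i (h j) t).det) (maxTropicalMinor A) := by
  by_cases hh : Function.Injective h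
  · refine GrowthLE.of_abs_le_sum (F := fun (σ : Equiv.Perm (Fin d)) t => ∏ i, M i (h (σ i)) t) 1
      zero_le_one (fun σ => ?_) (Eventually.of_forall fun t => ?_)
    · exact (GrowthLE.prod Finset.univ (fun i => hM i (h (σ i))) fun i => hA _ _).mono
        (sum_le_maxTropicalMinor A (hh.comp σ.injective))
    · rw [← Matrix.det_transpose, Matrix.det_apply, one_mul]
      refine (Finset.abs_sum_le_sum_abs _ _).trans_eq (Finset.sum_congr rfl fun σ _ => ?_)
      rcases Int.units_eq_one_or (Equiv.Perm.sign σ) with hs | hs <;> simp [hs]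
  · obtain ⟨i, j, hij, hne⟩ := Function.not_injective_iff.1 hh
    have h0 : ∀ t, (Matrix.of fun i j => M i (h j) t).det = 0 := fun t =>
      Matrix.det_zero_of_column_eq hne fun k => by simp [hij]
    intro r _
    filter_upwards [eventually_ge_atTop 0] with t ht
    simpa [h0] using Real.rpow_nonneg ht r

theorem growthLE_simplexDet {d m : ℕ} {A : Matrix (Fin d) (Fin m) EReal} (hA : ∀ i j, A i j ≠ ⊤)
    {M : Matrix (Fin d) (Fin m) (ℝ → ℝ)} (hM : ∀ i j, GrowthLE (M i j) (A i j))
    (g : Fin (d + 1) → Fin m) : GrowthLE (simplexDet M g) (maxTropicalMinor A) := by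
  refine GrowthLE.of_abs_le_sum 1 zero_le_one
    (fun k : Fin (d + 1) => growthLE_det hA hM fun j => g (k.succAbove j))
    (Eventually.of_forall fun t => ?_)
  rw [simplexDet, Matrix.det_succ_row_zero, one_mul]
  refine (Finset.abs_sum_le_sum_abs _ _).trans_eq (Finset.sum_congr rfl fun k _ => ?_)
  rw [homogenize_zero, mul_one, abs_mul, abs_pow, abs_neg, abs_one, one_pow, one_mul]
  rfl

/-! ### A lift attaining the bound -/

/-- The top-degree part of a multilinear map is an alternating sum of its values at the vertices of
a box. -/
theorem abs_multilinear_le_sum {ι E : Type*} [Fintype ι] [DecidableEq ι] [AddCommGroup E]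
    [Module ℝ E] (f : MultilinearMap ℝ (fun _ : ι => E) ℝ) (x u : ι → E) :
    |f u| ≤ ∑ s : Finset ι, |f (s.piecewise (x + u) x)| := by
  have h : f u = ∑ s : Finset ι, f (s.piecewise (x + u) (-x)) := by
    rw [← f.map_add_univ, add_neg_cancel_comm]
  -- By homogeneity, replacing the arguments `-x i` by `x i` only changes the sign of a term.
  rw [h]
  refine (Finset.abs_sum_le_sum_abs _ _).trans_eq (Finset.sum_congr rfl fun s _ => ?_)
  have h2 : s.piecewise (x + u) (-x) = sᶜ.piecewise
      (fun i => (-1 : ℝ) • (s.piecewise (x + u) x) i) (s.piecewise (x + u) x) := by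
    ext1 i
    by_cases hi : i ∈ s <;> simp [hi]
  rw [h2, f.map_piecewise_smul, smul_eq_mul, abs_mul]
  simp

/-- The lift of `A` by monomials in which the coefficient of the entry `(i, h i)` is doubled for
each `i ∈ s`, all other coefficients being one. -/
noncomputable def monomialLift {d m : ℕ} (A : Matrix (Fin d) (Fin m) EReal) (h : Fin d → Fin m)
    (s : Finset (Fin d)) : Matrix (Fin d) (Fin m) (ℝ → ℝ) :=
  Matrix.of fun i j t => (if i ∈ s ∧ j = h i then 2 else 1) * tropicalPower (A i j) t

theorem coe_tropicalPower_mem {K : Subring GermAtInfty}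
    (hpow : ∀ r : ℝ, ((fun t : ℝ => t ^ r : ℝ → ℝ) : GermAtInfty) ∈ K) (a : EReal) :
    ((tropicalPower a : ℝ → ℝ) : GermAtInfty) ∈ K := by
  by_cases ha : a = ⊥
  · have : tropicalPower a = 0 := by ext t; simp [tropicalPower, ha]
    rw [this]
    exact K.zero_mem
  · have : tropicalPower a = fun t => t ^ a.toReal := by ext t; simp [tropicalPower, ha]
    rw [this]
    exact hpow _

theorem isLift_monomialLift {K : Subring GermAtInfty}
    (hpow : ∀ r : ℝ, ((fun t : ℝ => t ^ r : ℝ → ℝ) : GermAtInfty) ∈ K)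
    {d m : ℕ} {A : Matrix (Fin d) (Fin m) EReal} (hA : ∀ i j, A i j ≠ ⊤) (h : Fin d → Fin m)
    (s : Finset (Fin d)) : IsLift K A (monomialLift A h s) := by
  intro i j
  have hmem := coe_tropicalPower_mem hpow (A i j)
  refine ⟨?_, ?_, ?_⟩
  · by_cases hc : i ∈ s ∧ j = h i
    · have : monomialLift A h s i j = tropicalPower (A i j) + tropicalPower (A i j) := by
        ext t; simp [monomialLift, hc, two_mul]
      rw [this]
      exact K.add_mem hmem hmem
    · have : monomialLift A h s i j = tropicalPower (A i j) := by
        ext t; simp [monomialLift, hc]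
      rwa [this]
  · refine Germ.coe_nonneg.2 ?_
    filter_upwards [eventually_ge_atTop 0] with t ht
    exact mul_nonneg (by split_ifs <;> norm_num) (tropicalPower_nonneg _ ht)
  · exact val_eq_of_tendsto (tendsto_logRatio_const_mul_tropicalPower
      (by split_ifs <;> norm_num) (hA i j))

/-- The homogenized determinant is multilinear in the rows of coordinates, and its top-degree part
in the entries `(i, h i)` is their product: here the extra column `j₀` is matched with the row of
ones. -/
theorem prod_tropicalPower_le_sum {d m : ℕ} (A : Matrix (Fin d) (Fin m) EReal) {h : Fin d → Fin m}
    (hh : Function.Injective h) {j₀ : Fin m} (hj : ∀ i, h i ≠ j₀) (t : ℝ) :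
    |∏ i, tropicalPower (A i (h i)) t| ≤
      ∑ s : Finset (Fin d), |simplexDet (monomialLift A h s) (Fin.cons j₀ h) t| := by
  let f : MultilinearMap ℝ (fun _ : Fin d => Fin (d + 1) → ℝ) ℝ :=
    (Matrix.detRowAlternating (n := Fin (d + 1)) (R := ℝ)).toMultilinearMap.curryLeft fun _ => 1
  let g : Fin (d + 1) → Fin m := Fin.cons j₀ h
  let x : Fin d → Fin (d + 1) → ℝ := fun i k => tropicalPower (A i (g k)) t
  let u : Fin d → Fin (d + 1) → ℝ := fun i => Pi.single i.succ (tropicalPower (A i (h i)) t)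
  have hg : ∀ (i : Fin d) (k : Fin (d + 1)), g k = h i ↔ k = i.succ := by
    intro i k
    refine Fin.cases ?_ (fun k => ?_) k
    · simpa [g, (Fin.succ_ne_zero i).symm] using (hj i).symm
    · simp [g, hh.eq_iff]
  have hu : f u = ∏ i, tropicalPower (A i (h i)) t := by
    change Matrix.det (Matrix.of (Fin.cons (fun _ => 1) u)) = _
    rw [Matrix.det_of_isUpperTriangular, Fin.prod_univ_succ]
    · simp [u]
    · intro i j hij
      induction i using Fin.cases with
      | zero => exact absurd hij (Fin.not_lt_zero _)
      | succ i => exact Pi.single_eq_of_ne (ne_of_lt hij) _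
  rw [← hu]
  refine (abs_multilinear_le_sum f x u).trans_eq (Finset.sum_congr rfl fun s _ => ?_)
  congr 1
  change Matrix.det (Matrix.of (Fin.cons (fun _ => 1) _)) = Matrix.det _
  congr 1
  ext i k
  induction i using Fin.cases with
  | zero => rfl
  | succ i =>
    change s.piecewise (x + u) x i k = monomialLift A h s i (g k) t
    by_cases hi : i ∈ s
    · by_cases hk : k = i.succ
      · subst hk
        simp [hi, x, u, monomialLift, g, two_mul]
      · simp [hi, x, u, monomialLift, hg, hk]
    · simp [hi, x, monomialLift]

end DequantizedVolume

theorem mainTheorem3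
    (L : FirstOrder.Language.{u, v}) [L.Structure ℝ]
    (hL : DequantizedVolume.IsOMinimal L) (hpb : DequantizedVolume.IsPolynomiallyBounded L)
    (K : Subring DequantizedVolume.GermAtInfty) (hK : DequantizedVolume.IsHardyField K)
    (hdef : ∀ f ∈ K, ∃ φ : ℝ → ℝ, DequantizedVolume.IsDefinableFun L φ ∧ f = φ)
    (hpow : ∀ r : ℝ, ((fun t : ℝ => t ^ r : ℝ → ℝ) : DequantizedVolume.GermAtInfty) ∈ K)
    (d m : ℕ) (hdm : m ≠ d)
    (A : Matrix (Fin d) (Fin m) EReal) (hA : ∀ i j, A i j ≠ ⊤) :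
    (∀ M : Matrix (Fin d) (Fin m) (ℝ → ℝ), DequantizedVolume.IsLift K A M →
      Tendsto (DequantizedVolume.logRatio (DequantizedVolume.vol M)) atTop
        (𝓝 (DequantizedVolume.val (DequantizedVolume.vol M)))) ∧
    DequantizedVolume.upperVolume K A =
      ⨆ (I : Finset (Fin m)) (hI : I.card = d),
        DequantizedVolume.tropDet (DequantizedVolume.columnSubmatrix A I hI) := by
  open DequantizedVolume in
  have hdet : ∀ M, IsLift K A M → ∀ g, Tendsto (logRatio (simplexDet M g)) atTop
      (𝓝 (val (simplexDet M g))) := fun M hM g =>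
    hK.tendsto_logRatio_val hpow (simplexDet_mem (fun i j => (hM i j).1) g)
  have hvol : ∀ M, IsLift K A M → Tendsto (logRatio (vol M)) atTop
      (𝓝 (⨆ g, val (simplexDet M g))) := fun M hM => tendsto_logRatio_vol (hdet M hM)
  refine ⟨fun M hM => by rw [val_eq_of_tendsto (hvol M hM)]; exact hvol M hM, ?_⟩
  change upperVolume K A = maxTropicalMinor A
  refine le_antisymm (sSup_le ?_) (maxTropicalMinor_le fun h hh => ?_)
  · rintro _ ⟨M, hM, rfl⟩
    rw [val_eq_of_tendsto (hvol M hM)]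
    refine iSup_le fun g => (tendsto_logRatio_iff.1 (hdet M hM g)).2.le_of_growthLE
      (growthLE_simplexDet hA (fun i j => ?_) g)
    have := hK.tendsto_logRatio_val hpow (hM i j).1
    rw [(hM i j).2.2] at this
    exact (tendsto_logRatio_iff.1 this).1
  · -- Since `m ≠ d`, the injection `h` misses a column, which serves as the last vertex.
    obtain ⟨j₀, hj⟩ : ∃ j₀, ∀ i, h i ≠ j₀ := by
      by_contra! hsurj
      exact hdm (by simpa using (Fintype.card_of_bijective ⟨hh, hsurj⟩).symm)
    let M : Finset (Fin d) → Matrix (Fin d) (Fin m) (ℝ → ℝ) := monomialLift A h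
    have hM : ∀ s, IsLift K A (M s) := isLift_monomialLift hpow hA h
    let w : EReal := ∑ i, A i (h i)
    have hw : Tendsto (logRatio fun t => 1 * tropicalPower w t) atTop (𝓝 w) :=
      tendsto_logRatio_const_mul_tropicalPower one_ne_zero (sum_ne_top _ fun i => hA i (h i))
    refine (tendsto_logRatio_iff.1 hw).2.le_of_growthLE ?_
    refine GrowthLE.of_abs_le_sum (F := fun s => simplexDet (M s) (Fin.cons j₀ h)) 1 zero_le_one
      (fun s => (tendsto_logRatio_iff.1 (hdet _ (hM s) _)).1.mono ?_) ?_
    · refine le_trans ?_ (le_sSup ⟨M s, hM s, rfl⟩)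
      rw [val_eq_of_tendsto (hvol _ (hM s))]
      exact le_iSup (fun g => val (simplexDet (M s) g)) _
    · filter_upwards [eventually_gt_atTop 0] with t ht
      rw [one_mul, one_mul, tropicalPower_sum _ (fun i => hA i (h i)) ht]
      exact prod_tropicalPower_le_sum A hh hj t
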